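/- Hub model with a null component: among $n$ nodes $1,\dots,n$, the first $n_L\le n$ are the leaders. One observes $T$ independent groups $G^{(t)}\in\{0,1\}^n$, $t=1,\dots,T$. Each has a latent label $z_*^{(t)}\in\{0,1,\dots,n_L\}$ (label $0$ means no hub) with $\mathbb P(z_*^{(t)}=i)=\rho_i$, and given $z_*^{(t)}=i$ the nodes appear independently, node $j$ with probability $A_{ij}$, where $A_{ij}\in[0,1]$, $A_{0j}=\pi_j$ are the null-component probabilities, and $A_{ii}=1$ for $1\le i\le n_L$. For labels $z\in\{0,\dots,n_L\}^T$ let $\hat A^z_{ij}=\sum_t G^{(t)}_j1(z^{(t)}=i)/\sum_t 1(z^{(t)}=i)$, and let $\hat z$ be any maximizer over $z$ of the profile log-likelihood $$L_G(z)=\sup_{A}\sum_{t=1}^T\sum_{j=1}^n\big[G_j^{(t)}\log A_{z^{(t)}j}+(1-G_j^{(t)})\log(1-A_{z^{(t)}j})\big],$$ where $A$ ranges over all $(n_L+1)\times n$ matrices (rows indexed from $0$) with entries in $[0,1]$ and $A_{ii}=1$ for $1\le i\le n_L$, with $\log 0=-\infty$ and $0\cdot(-\infty)=0$ (so $L_G(z)=-\infty$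 if some group is labelled by a leader absent from it). All quantities $n,T,\rho,A,d>0,v>0$ (and $n_L$ in (a)) may vary along a sequence; $c_{\min},c_{\max},c_0,b$ are constants. Assume the separation condition (S) for each $i=1,\dots,n_L$ there is $V_i\subset\{1,\dots,n\}$ with $|V_i|\ge vn/n_L$ and $A_{ij}-A_{i'j}\ge d$ for all $j\in V_i$ and all $i'\in\{0,\dots,n_L\}$, $i'\ne i$. (a) Suppose $n_L,n,T\to\infty$; $c_{\min}/n_L\le\rho_i\le c_{\max}/n_L$ for $i=0,\dots,n_L$ with $c_{\min},c_{\max}>0$; $A_{ii'}\le c_0/n_L$ for all $0\le i\le n_L$, $1\le i'\le n_L$, $i\ne i'$, with $c_0>0$; and $$\frac{n_L^2\log n_L}{T}\to0,\quad \frac{n_L^5\log T}{d^2vT}\to0,\quad \frac{n_L^8\log n_L}{d^4v^2n}\to0,\quad \frac{n_L\log n}{T}\to0 .$$ Then $$\max_{0\le i\le n_L,\ 1\le j\le n}\big|\hat A^{\hat z}_{ij}-A_{ij}\big|=o_p(1).$$ (b) Suppose $n_L$ is fixed, $n,T\to\infty$; $\rho_i\ge c_{\min}>0$ for $i=0,\dots,n_L$;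 $A_{ii'}\le b<1$ for all $0\le i\le n_L$, $1\le i'\le n_L$, $i\ne i'$; and $$\frac{\log T}{d^2vT}\to0,\quad d^4v^2n\to\infty,\quad \frac{\log n}{T}\to0 .$$ Then the same conclusion holds. -/

import Mathlib

open MeasureTheory Filter Topology

noncomputable section

/-- Labels are `Fin (nL + 1)`: label `0` is the null component (hubless groups), and label
`k.succ` is the `k`-th leader. Nodes are `Fin n`. The leaders are the first `nL` nodes;
`hubNode h k` is the node of the `k`-th leader. -/
def hubNode {nL n : ℕ} (h : nL ≤ n) (k : Fin nL) : Fin n := Fin.castLE h k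

/-- The admissible matrices `A` (row `0` is `π`): entries in `[0, 1]`, and every leader is
surely present in the groups of which it is the hub. -/
def hubMatrices {nL n : ℕ} (h : nL ≤ n) : Set (Fin (nL + 1) → Fin n → ℝ) :=
  {A | (∀ i j, 0 ≤ A i j ∧ A i j ≤ 1) ∧ ∀ k : Fin nL, A k.succ (hubNode h k) = 1}

/-- Parameters of the hub model with a null component, with `nL` leaders among `n` nodes. -/
structure HubParams (nL n : ℕ) where
  le : nL ≤ n
  ρ : Fin (nL + 1) → ℝ
  A : Fin (nL + 1) → Fin n → ℝ
  ρ_nonneg : ∀ i, 0 ≤ ρ i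
  ρ_sum : ∑ i, ρ i = 1
  A_mem : A ∈ hubMatrices le

/-- `p ^ b * (1 - p) ^ (1 - b)`. -/
def bern (p : ℝ) (b : Bool) : ℝ := if b then p else 1 - p

/-- `(zstar, G)` is a sample of `T` independent groups (with their true labels) from the hub model
with a null component: in each group, the label is `i` with probability `ρ i` and, given the
label `i`, the nodes `j` appear independently with probabilities `A i j`. -/
structure IsHubSample {nL n T : ℕ} {Ω : Type*} [MeasurableSpace Ω] (P : HubParams nL n)
    (μ : Measure Ω) (zstar : Ω → Fin T → Fin (nL + 1)) (G : Ω → Fin T → Fin n → Bool) :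
    Prop where
  measurable_zstar : Measurable zstar
  measurable_G : Measurable G
  law : ∀ (z : Fin T → Fin (nL + 1)) (g : Fin T → Fin n → Bool),
    μ {ω | zstar ω = z ∧ G ω = g} =
      ENNReal.ofReal (∏ t, (P.ρ (z t) * ∏ j, bern (P.A (z t) j) (g t j)))

/-- The log-likelihood `L_G(A | z)` of the data `g` given the labels `z`, with `log 0 = -∞`. -/
def condLogLik {nL n T : ℕ} (g : Fin T → Fin n → Bool) (A : Fin (nL + 1) → Fin n → ℝ)
    (z : Fin T → Fin (nL + 1)) : EReal :=
  ∑ t, ∑ j, ENNReal.log (ENNReal.ofReal (bern (A (z t) j) (g t j)))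

/-- The profile log-likelihood `L_G(z)`: the supremum of `L_G(A | z)` over admissible `A`.
It is `-∞` when some group is labelled by a leader that does not belong to it. -/
def profileLogLik {nL n T : ℕ} (h : nL ≤ n) (g : Fin T → Fin n → Bool)
    (z : Fin T → Fin (nL + 1)) : EReal :=
  ⨆ A ∈ hubMatrices (nL := nL) (n := n) h, condLogLik g A z

/-- `zhat` is a maximum profile likelihood assignment of labels for the data `g`. -/
def IsMaxProfile {nL n T : ℕ} (h : nL ≤ n) (g : Fin T → Fin n → Bool)
    (zhat : Fin T → Fin (nL + 1)) : Prop :=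
  ∀ z, profileLogLik h g z ≤ profileLogLik h g zhat

/-- `Â_ij^z`: the proportion of the groups labelled `i` by `z` in which node `j` appears. -/
def Ahat {nL n T : ℕ} (g : Fin T → Fin n → Bool) (z : Fin T → Fin (nL + 1))
    (i : Fin (nL + 1)) (j : Fin n) : ℝ :=
  (∑ t, if z t = i ∧ g t j = true then (1 : ℝ) else 0) / ∑ t, if z t = i then (1 : ℝ) else 0

/-- `max_{i, j} |Â_ij^z - A_ij|` over all labels `i` (null included) and all nodes `j`. -/
def maxError {nL n T : ℕ} (P : HubParams nL n) (g : Fin T → Fin n → Bool)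
    (z : Fin T → Fin (nL + 1)) : ℝ :=
  ⨆ p : Fin (nL + 1) × Fin n, |Ahat g z p.1 p.2 - P.A p.1 p.2|

/-- For every leader there is a set `V` of at least `v * n / nL` nodes each of which is more
likely, by at least `d`, to appear in its groups than in those of any other label. -/
def HubParams.Separated {nL n : ℕ} (P : HubParams nL n) (d v : ℝ) : Prop :=
  ∃ V : Fin nL → Finset (Fin n), ∀ k : Fin nL,
    v * n / nL ≤ ((V k).card : ℝ) ∧
    ∀ j ∈ V k, ∀ i : Fin (nL + 1), i ≠ k.succ → d ≤ P.A k.succ j - P.A i j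

/-- A leader appears with probability at most `b` in the groups of any other label. -/
def HubParams.CrossLE {nL n : ℕ} (P : HubParams nL n) (b : ℝ) : Prop :=
  ∀ (i : Fin (nL + 1)) (k : Fin nL), i ≠ k.succ → P.A i (hubNode P.le k) ≤ b

/-- `X m = o_p(1)` as `m → ∞`, where `X m` lives on its own probability space. -/
def IsLittleOP {Ω : ℕ → Type*} [∀ m, MeasurableSpace (Ω m)] (μ : ∀ m, Measure (Ω m))
    (X : ∀ m, Ω m → ℝ) : Prop :=
  ∀ ε : ℝ, 0 < ε → Tendsto (fun m => μ m {ω | ε ≤ |X m ω|}) atTop (𝓝 0)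

end

/-!
By Gibbs' inequality the profile likelihood of a labelling `z` is at most the likelihood of the
empirical frequencies `Ahat g z`. If `z` puts `η` groups of each of two different true labels under
one label, then no probabilities for that label fit both kinds of groups: by the separation
condition the Bhattacharyya bound makes such a fit as good as the truth only with probability
`exp (-c η d² v n / nL)`. The empirical frequencies of all labellings range over a grid, so a union
bound over the labellings and the grid shows that with high probability `zhat` mixes no two labels.
Counting labels, `zhat` then agrees with the true labels up to a permutation, apart from few
groups. A leader is present in all groups that `zhat` gives to it but rarely in the groups of other
labels, which forces this permutation to be the identity. So the frequencies under `zhat` are close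
to those under the true labels, which Hoeffding's inequality places near the true probabilities.
-/

open ProbabilityTheory Asymptotics
open scoped unitInterval

lemma bern_nonneg (p : I) (b : Bool) : 0 ≤ bern p b := by
  cases b
  · simpa [bern] using p.2.2
  · simpa [bern] using p.2.1

lemma ennrealLog_prod {ι : Type*} (s : Finset ι) (f : ι → ENNReal) :
    ENNReal.log (∏ i ∈ s, f i) = ∑ i ∈ s, ENNReal.log (f i) := by
  classical
  induction s using Finset.induction_on with
  | empty => simp
  | insert a s ha ih => rw [Finset.prod_insert ha, Finset.sum_insert ha, ENNReal.log_mul_add, ih]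

lemma prod_le_prod_of_sum_div_le_card {ι : Type*} {s : Finset ι} {a b : ι → ℝ}
    (ha : ∀ i ∈ s, 0 ≤ a i) (hb : ∀ i ∈ s, 0 < b i) (h : ∑ i ∈ s, a i / b i ≤ s.card) :
    ∏ i ∈ s, a i ≤ ∏ i ∈ s, b i := by
  have hsum : ∑ i ∈ s, (a i / b i - 1) ≤ 0 := by simpa [Finset.sum_sub_distrib] using h
  have hdiv : ∏ i ∈ s, a i / b i ≤ 1 :=
    calc ∏ i ∈ s, a i / b i ≤ ∏ i ∈ s, Real.exp (a i / b i - 1) :=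
          Finset.prod_le_prod (fun i hi => div_nonneg (ha i hi) (hb i hi).le) fun i _ => by
            linarith [Real.add_one_le_exp (a i / b i - 1)]
      _ = Real.exp (∑ i ∈ s, (a i / b i - 1)) := (Real.exp_sum _ _).symm
      _ ≤ 1 := Real.exp_le_one_iff.2 hsum
  rwa [Finset.prod_div_distrib, div_le_one (Finset.prod_pos hb)] at hdiv

lemma mul_div_div_le {x r : ℝ} (hx : 0 ≤ x) (hr : 0 ≤ r) (s : ℝ) : s * (x / (s / r)) ≤ x * r := by
  rcases eq_or_ne s 0 with rfl | hs
  · simpa using mul_nonneg hx hr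
  · exact le_of_eq (by field_simp)

section Frequency

variable {ι : Type*} (s : Finset ι) (h : ι → Bool)

lemma one_sub_card_filter_div_card (hs : s.Nonempty) :
    1 - ((s.filter (h · = true)).card : ℝ) / s.card = (s.filter (¬ h · = true)).card / s.card := by
  have hcard : (0 : ℝ) < s.card := by exact_mod_cast hs.card_pos
  rw [eq_div_iff hcard.ne', sub_mul, one_mul, div_mul_cancel₀ _ hcard.ne', sub_eq_iff_eq_add']
  exact_mod_cast (Finset.card_filter_add_card_filter_not _).symm

lemma bern_card_filter_div_card_pos {t : ι} (ht : t ∈ s) :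
    0 < bern ((s.filter (h · = true)).card / s.card) (h t) := by
  have hs : 0 < s.card := Finset.card_pos.2 ⟨t, ht⟩
  by_cases hh : h t = true
  · have : 0 < (s.filter (h · = true)).card :=
      Finset.card_pos.2 ⟨t, Finset.mem_filter.2 ⟨ht, hh⟩⟩
    simp only [bern, hh, if_true]
    positivity
  · have : 0 < (s.filter (¬ h · = true)).card :=
      Finset.card_pos.2 ⟨t, Finset.mem_filter.2 ⟨ht, hh⟩⟩
    simp only [bern, if_neg hh, one_sub_card_filter_div_card s h ⟨t, ht⟩]
    positivity

lemma sum_bern_div_bern_freq_le (x : I) :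
    ∑ t ∈ s, bern x (h t) / bern ((s.filter (h · = true)).card / s.card) (h t) ≤ s.card := by
  rcases s.eq_empty_or_nonempty with rfl | hs
  · simp
  set p := (s.filter (h · = true)).card
  set q := (s.filter (¬ h · = true)).card
  have hq : 1 - (p : ℝ) / s.card = q / s.card := one_sub_card_filter_div_card s h hs
  have hpresent : ∑ t ∈ s with h t = true, bern x (h t) / bern (p / s.card) (h t) =
      p * (x / (p / s.card)) := by
    rw [← nsmul_eq_mul]
    exact Finset.sum_eq_card_nsmul fun t ht => by simp [bern, (Finset.mem_filter.1 ht).2]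
  have habsent : ∑ t ∈ s with ¬ h t = true, bern x (h t) / bern (p / s.card) (h t) =
      q * ((1 - x) / (q / s.card)) := by
    rw [← nsmul_eq_mul, ← hq]
    exact Finset.sum_eq_card_nsmul fun t ht => by simp [bern, (Finset.mem_filter.1 ht).2]
  calc ∑ t ∈ s, bern x (h t) / bern (p / s.card) (h t)
      = p * (x / (p / s.card)) + q * ((1 - x) / (q / s.card)) := by
        rw [← Finset.sum_filter_add_sum_filter_not s (h · = true), hpresent, habsent]
    _ ≤ x * s.card + (1 - x) * s.card :=
        add_le_add (mul_div_div_le x.2.1 (Nat.cast_nonneg _) _)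
          (mul_div_div_le (sub_nonneg.2 x.2.2) (Nat.cast_nonneg _) _)
    _ = s.card := by ring

lemma prod_bern_le_prod_bern_freq (x : I) :
    ∏ t ∈ s, bern x (h t) ≤ ∏ t ∈ s, bern ((s.filter (h · = true)).card / s.card) (h t) :=
  prod_le_prod_of_sum_div_le_card (fun t _ => bern_nonneg x (h t))
    (fun _ => bern_card_filter_div_card_pos s h) (sum_bern_div_bern_freq_le s h x)

end Frequency

section Likelihood

variable {τ κ ν : Type*} [Fintype τ] [Fintype ν]

/-- The likelihood of the data `g` given the labels `z` when the nodes of a group labelled `a`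
appear independently with probabilities `A a`. -/
noncomputable def lik (g : τ → ν → Bool) (A : κ → ν → I) (z : τ → κ) : ℝ :=
  ∏ t, ∏ j, bern (A (z t) j) (g t j)

lemma lik_nonneg (g : τ → ν → Bool) (A : κ → ν → I) (z : τ → κ) : 0 ≤ lik g A z :=
  Finset.prod_nonneg fun _ _ => Finset.prod_nonneg fun _ _ => bern_nonneg _ _

end Likelihood

section EmpiricalFrequency

variable {τ κ ν : Type*} [Fintype τ] [DecidableEq κ]

/-- The number of groups labelled `a` by `z`. -/
def labelCount (z : τ → κ) (a : κ) : ℕ := (Finset.univ.filter (z · = a)).card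

/-- The number of groups labelled `a` by `z` in which the node `j` appears. -/
def presence (g : τ → ν → Bool) (z : τ → κ) (a : κ) (j : ν) : ℕ :=
  (Finset.univ.filter fun t => z t = a ∧ g t j = true).card

lemma presence_le_labelCount (g : τ → ν → Bool) (z : τ → κ) (a : κ) (j : ν) :
    presence g z a j ≤ labelCount z a :=
  Finset.card_le_card <| Finset.monotone_filter_right _ fun _ _ => And.left

/-- The empirical frequency `Ahat` as an element of the unit interval, for arbitrary finite types
of groups, labels and nodes. It is `0` for an unused label. -/
noncomputable def freq (g : τ → ν → Bool) (z : τ → κ) (a : κ) (j : ν) : I :=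
  ⟨presence g z a j / labelCount z a, by positivity,
    div_le_one_of_le₀ (by exact_mod_cast presence_le_labelCount g z a j) (by positivity)⟩

lemma sum_ite_appears_sub (A : κ → ν → I) (g : τ → ν → Bool) {z : τ → κ} {a : κ}
    (ha : labelCount z a ≠ 0) (j : ν) :
    ∑ t with z t = a, ((if g t j = true then (1 : ℝ) else 0) - A (z t) j) =
      labelCount z a * ((freq g z a j : ℝ) - A a j) := by
  have hmean : ∑ t with z t = a, (A (z t) j : ℝ) = labelCount z a * A a j := by
    rw [← nsmul_eq_mul]
    exact Finset.sum_eq_card_nsmul fun t ht => by rw [(Finset.mem_filter.1 ht).2]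
  rw [Finset.sum_sub_distrib, hmean, Finset.sum_boole, Finset.filter_filter, mul_sub,
    freq, mul_div_cancel₀ _ (Nat.cast_ne_zero.2 ha), presence]

variable [Fintype ν]

lemma lik_eq_prod_label (g : τ → ν → Bool) (A : κ → ν → I) (z : τ → κ) :
    lik g A z = ∏ j, ∏ a ∈ Finset.univ.image z, ∏ t with z t = a, bern (A a j) (g t j) := by
  rw [lik, Finset.prod_comm]
  refine Finset.prod_congr rfl fun j _ => ?_
  rw [← Finset.prod_fiberwise_of_maps_to fun t _ => Finset.mem_image_of_mem z (Finset.mem_univ t)]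
  exact Finset.prod_congr rfl fun a _ => Finset.prod_congr rfl fun t ht => by
    rw [(Finset.mem_filter.1 ht).2]

lemma lik_le_lik_freq (g : τ → ν → Bool) (A : κ → ν → I) (z : τ → κ) :
    lik g A z ≤ lik g (freq g z) z := by
  rw [lik_eq_prod_label, lik_eq_prod_label]
  refine Finset.prod_le_prod (fun j _ => Finset.prod_nonneg fun a _ => Finset.prod_nonneg
    fun t _ => bern_nonneg _ _) fun j _ => Finset.prod_le_prod (fun a _ => Finset.prod_nonneg
    fun t _ => bern_nonneg _ _) fun a _ => ?_
  have hmax := prod_bern_le_prod_bern_freq (Finset.univ.filter (z · = a)) (g · j) (A a j)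
  rwa [Finset.filter_filter] at hmax

end EmpiricalFrequency

section MaxProfile

variable {nL n T : ℕ} {h : nL ≤ n} {g : Fin T → Fin n → Bool} {zhat : Fin T → Fin (nL + 1)}
  {A : Fin (nL + 1) → Fin n → I}

lemma Ahat_eq_freq (g : Fin T → Fin n → Bool) (z : Fin T → Fin (nL + 1)) (a : Fin (nL + 1))
    (j : Fin n) : Ahat g z a j = freq g z a j := by
  simp [Ahat, freq, presence, labelCount, Finset.sum_boole]

lemma condLogLik_eq_log_lik (g : Fin T → Fin n → Bool) (A : Fin (nL + 1) → Fin n → I)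
    (z : Fin T → Fin (nL + 1)) :
    condLogLik g (fun a j => A a j) z = ENNReal.log (ENNReal.ofReal (lik g A z)) := by
  rw [lik, ENNReal.ofReal_prod_of_nonneg fun t _ => Finset.prod_nonneg fun j _ => bern_nonneg _ _,
    ennrealLog_prod]
  refine Finset.sum_congr rfl fun t _ => ?_
  rw [ENNReal.ofReal_prod_of_nonneg fun j _ => bern_nonneg _ _, ennrealLog_prod]

lemma condLogLik_ne_bot_iff_lik_pos {z : Fin T → Fin (nL + 1)} :
    condLogLik g (fun a j => A a j) z ≠ ⊥ ↔ 0 < lik g A z := by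
  rw [condLogLik_eq_log_lik, Ne, ENNReal.log_eq_bot_iff, ENNReal.ofReal_eq_zero, not_le]

/-- An admissible matrix of the model as a matrix with entries in the unit interval. -/
def unitMatrix {B : Fin (nL + 1) → Fin n → ℝ} (hB : B ∈ hubMatrices h) :
    Fin (nL + 1) → Fin n → I :=
  fun a j => ⟨B a j, hB.1 a j⟩

lemma profileLogLik_le_log_lik_freq (h : nL ≤ n) (g : Fin T → Fin n → Bool)
    (z : Fin T → Fin (nL + 1)) :
    profileLogLik h g z ≤ ENNReal.log (ENNReal.ofReal (lik g (freq g z) z)) :=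
  iSup₂_le fun _ hB => (condLogLik_eq_log_lik g (unitMatrix hB) z).trans_le <|
    ENNReal.log_monotone <| ENNReal.ofReal_le_ofReal (lik_le_lik_freq g (unitMatrix hB) z)

lemma IsMaxProfile.condLogLik_le (hz : IsMaxProfile h g zhat)
    (hA : (fun a j => (A a j : ℝ)) ∈ hubMatrices h) (z : Fin T → Fin (nL + 1)) :
    condLogLik g (fun a j => A a j) z ≤ profileLogLik h g zhat :=
  (le_iSup₂ (f := fun B (_ : B ∈ hubMatrices h) => condLogLik g B z) _ hA).trans (hz z)

lemma IsMaxProfile.lik_le (hz : IsMaxProfile h g zhat)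
    (hA : (fun a j => (A a j : ℝ)) ∈ hubMatrices h) (z : Fin T → Fin (nL + 1)) :
    lik g A z ≤ lik g (freq g zhat) zhat := by
  have hlog := (hz.condLogLik_le hA z).trans (profileLogLik_le_log_lik_freq h g zhat)
  rw [condLogLik_eq_log_lik, ENNReal.log_le_log_iff] at hlog
  exact (ENNReal.ofReal_le_ofReal_iff (lik_nonneg _ _ _)).1 hlog

lemma mem_group_of_lik_pos (hA : (fun a j => (A a j : ℝ)) ∈ hubMatrices h)
    {z : Fin T → Fin (nL + 1)} (hpos : 0 < lik g A z) {t : Fin T} {k : Fin nL}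
    (ht : z t = k.succ) : g t (hubNode h k) = true := by
  have hfactor := Finset.prod_ne_zero_iff.1 (Finset.prod_ne_zero_iff.1 hpos.ne' t
    (Finset.mem_univ _)) (hubNode h k) (Finset.mem_univ _)
  rw [ht, show (A k.succ (hubNode h k) : ℝ) = 1 from hA.2 k] at hfactor
  by_contra habsent
  simp [bern, habsent] at hfactor

lemma IsMaxProfile.hub_mem (hz : IsMaxProfile h g zhat)
    (hA : (fun a j => (A a j : ℝ)) ∈ hubMatrices h) {z : Fin T → Fin (nL + 1)}
    (hpos : 0 < lik g A z) {t : Fin T} {k : Fin nL} (ht : zhat t = k.succ) :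
    g t (hubNode h k) = true := by
  have hbot : ⊥ < profileLogLik h g zhat :=
    (bot_lt_iff_ne_bot.2 (condLogLik_ne_bot_iff_lik_pos.2 hpos)).trans_le (hz.condLogLik_le hA z)
  simp only [profileLogLik, lt_iSup_iff] at hbot
  obtain ⟨B, hB, hbot⟩ := hbot
  exact mem_group_of_lik_pos (A := unitMatrix hB) hB
    (condLogLik_ne_bot_iff_lik_pos.1 (bot_lt_iff_ne_bot.1 hbot)) ht

end MaxProfile

section Confusion

variable {τ κ ν : Type*} [Fintype τ] [DecidableEq κ] {z w : τ → κ} {η : ℝ}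

/-- The number of groups labelled `a` by `z` and `b` by `w`. -/
def confusion (z w : τ → κ) (a b : κ) : ℕ := (Finset.univ.filter fun t => z t = a ∧ w t = b).card

/-- Some label of `w` contains at least `η` groups of each of two different labels of `z`. -/
def Mixes (η : ℝ) (z w : τ → κ) : Prop :=
  ∃ b a a', a ≠ a' ∧ η ≤ confusion z w a b ∧ η ≤ confusion z w a' b

lemma confusion_comm (z w : τ → κ) (a b : κ) : confusion z w a b = confusion w z b a := by
  simp only [confusion, and_comm]

lemma confusion_le_presence {g : τ → ν → Bool} {b : κ} {j : ν} (h : ∀ t, w t = b → g t j = true)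
    (a : κ) : confusion z w a b ≤ presence g z a j :=
  Finset.card_le_card <| Finset.monotone_filter_right _ fun t _ ht => ⟨ht.1, h t ht.2⟩

lemma labelCount_eq_confusion_add (z w : τ → κ) (a c : κ) :
    labelCount z a =
      confusion z w a c + (Finset.univ.filter fun t => z t = a ∧ w t ≠ c).card := by
  simp only [labelCount, confusion, ← Finset.filter_filter]
  exact (Finset.card_filter_add_card_filter_not _).symm

lemma card_filter_label_le_add (z w : τ → κ) (a : κ) (s : Finset τ) :
    (s.filter (z · = a)).card ≤
      (s.filter (w · = a)).card + (Finset.univ.filter fun t => z t = a ∧ w t ≠ a).card := by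
  classical
  refine (Finset.card_le_card fun t ht => ?_).trans (Finset.card_union_le _ _)
  simp only [Finset.mem_union, Finset.mem_filter, Finset.mem_univ, true_and] at ht ⊢
  tauto

variable [Fintype κ]

lemma sum_confusion (z w : τ → κ) (a : κ) : ∑ b, confusion z w a b = labelCount z a := by
  simp only [confusion, labelCount, ← Finset.filter_filter]
  exact (Finset.card_eq_sum_card_fiberwise fun _ _ => Finset.mem_coe.2 (Finset.mem_univ _)).symm

lemma card_label_ne_le {a c : κ} (hη : 0 ≤ η) (h : ∀ b, b ≠ c → confusion z w a b ≤ η) :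
    ((Finset.univ.filter fun t => z t = a ∧ w t ≠ c).card : ℝ) ≤ Fintype.card κ * η :=
  calc ((Finset.univ.filter fun t => z t = a ∧ w t ≠ c).card : ℝ)
      = ∑ b ∈ Finset.univ.erase c, (confusion z w a b : ℝ) := by
        have hsum := Finset.add_sum_erase _ (confusion z w a) (Finset.mem_univ c)
        rw [sum_confusion, labelCount_eq_confusion_add z w a c, Nat.add_left_cancel_iff] at hsum
        exact_mod_cast hsum.symm
    _ ≤ (Finset.univ.erase c).card * η :=
        (Finset.sum_le_card_nsmul _ _ _ fun b hb => h b (Finset.ne_of_mem_erase hb)).trans_eq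
          (nsmul_eq_mul _ _)
    _ ≤ Fintype.card κ * η := by gcongr; exact Finset.card_le_univ _

lemma exists_perm_confusion_le (hmix : ¬ Mixes η z w)
    (hbig : ∀ a, Fintype.card κ * η < labelCount z a) :
    ∃ ψ : Equiv.Perm κ, ∀ a b, b ≠ ψ a → confusion z w a b ≤ η := by
  have hmajority : ∀ b, ∃ a, ∀ a', a' ≠ a → confusion z w a' b ≤ η := by
    intro b
    by_cases hb : ∃ a, η ≤ confusion z w a b
    · obtain ⟨a, ha⟩ := hb
      exact ⟨a, fun a' ha' => le_of_not_ge fun h => hmix ⟨b, a, a', ha'.symm, ha, h⟩⟩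
    · exact ⟨b, fun a' _ => le_of_not_ge fun h => hb ⟨a', h⟩⟩
  choose φ hφ using hmajority
  have hsurj : Function.Surjective φ := by
    intro a
    by_contra! hmiss
    have hsmall : ∑ b, (confusion z w a b : ℝ) ≤ Fintype.card κ * η :=
      (Finset.sum_le_card_nsmul _ _ _ fun b _ => hφ b a (hmiss b).symm).trans_eq
        (nsmul_eq_mul _ _)
    have hcount : (labelCount z a : ℝ) = ∑ b, (confusion z w a b : ℝ) := by
      exact_mod_cast (sum_confusion z w a).symm
    exact (hbig a).not_ge (hcount.trans_le hsmall)
  refine ⟨(Equiv.ofBijective φ (Finite.surjective_iff_bijective.1 hsurj)).symm,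
    fun a b hb => hφ b a fun h => hb ?_⟩
  rw [Equiv.eq_symm_apply, Equiv.ofBijective_apply, h]

lemma abs_card_filter_label_sub_le (hη : 0 ≤ η)
    (h : ∀ a b, b ≠ a → (confusion z w a b : ℝ) ≤ η) (a : κ) (s : Finset τ) :
    |((s.filter (w · = a)).card : ℝ) - (s.filter (z · = a)).card| ≤ Fintype.card κ * η := by
  have hzw := card_filter_label_le_add z w a s
  have hwz := card_filter_label_le_add w z a s
  have hz := card_label_ne_le hη (h a)
  have hw := card_label_ne_le (z := w) (w := z) (a := a) hη fun b hb => by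
    rw [confusion_comm]; exact h b a hb.symm
  rify at hzw hwz
  rw [abs_le]
  constructor <;> linarith

lemma abs_div_sub_div_le {s r s' r' e : ℝ} (hr : 0 < r) (hs' : 0 ≤ s') (hsr : s' ≤ r')
    (hs : |s' - s| ≤ e) (hr' : |r' - r| ≤ e) : |s' / r' - s / r| ≤ 2 * e / r := by
  have hfrac : s' / r' - s / r = ((s' - s) - s' / r' * (r' - r)) / r := by
    rcases eq_or_ne r' 0 with rfl | h
    · simp [hsr.antisymm hs', neg_div]
    · field_simp
      ring
  have hfrac0 : 0 ≤ s' / r' := div_nonneg hs' (hs'.trans hsr)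
  have hfrac1 : s' / r' ≤ 1 := div_le_one_of_le₀ hsr (hs'.trans hsr)
  rw [hfrac, abs_div, abs_of_pos hr]
  refine div_le_div_of_nonneg_right ?_ hr.le
  calc |(s' - s) - s' / r' * (r' - r)| ≤ |s' - s| + |s' / r' * (r' - r)| := abs_sub _ _
    _ ≤ e + 1 * e := by
      rw [abs_mul, abs_of_nonneg hfrac0]
      exact add_le_add hs (mul_le_mul hfrac1 hr' (abs_nonneg _) zero_le_one)
    _ = 2 * e := by ring

lemma abs_freq_sub_freq_le (g : τ → ν → Bool) (hη : 0 ≤ η) {a : κ} (ha : 0 < labelCount z a)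
    (h : ∀ a b, b ≠ a → (confusion z w a b : ℝ) ≤ η) (j : ν) :
    |(freq g w a j : ℝ) - freq g z a j| ≤ 2 * (Fintype.card κ * η) / labelCount z a := by
  have hpresence (y : τ → κ) :
      presence g y a j = ((Finset.univ.filter (g · j = true)).filter (y · = a)).card := by
    simp only [presence, Finset.filter_filter, and_comm]
  refine abs_div_sub_div_le (mod_cast ha) (Nat.cast_nonneg _)
    (mod_cast presence_le_labelCount g w a j) ?_ ?_
  · rw [hpresence, hpresence]
    exact abs_card_filter_label_sub_le hη h a _
  · exact abs_card_filter_label_sub_le hη h a _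

end Confusion

/-- The data `g` with labels `z` are typical for the probabilities `A`: every label is used at
least `N` times and all empirical frequencies are `e`-close to `A`. -/
structure IsTypical {τ κ ν : Type*} [Fintype τ] [DecidableEq κ] (A : κ → ν → I) (N e : ℝ)
    (g : τ → ν → Bool) (z : τ → κ) : Prop where
  le_labelCount : ∀ a, N ≤ labelCount z a
  abs_freq_sub_le : ∀ a j, |(freq g z a j : ℝ) - A a j| ≤ e

/-- The data `g` are typical for the true labels `z`, and no labels that mix those of `z` explain
them as well as the model does. -/
structure IsInformative {τ κ ν : Type*} [Fintype τ] [Fintype ν] [DecidableEq κ] (A : κ → ν → I)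
    (N e η : ℝ) (g : τ → ν → Bool) (z : τ → κ) : Prop extends IsTypical A N e g z where
  lik_pos : 0 < lik g A z
  lik_lt : ∀ w, Mixes η z w → lik g (freq g w) w < lik g A z

section Recovery

variable {nL n T : ℕ} {P : HubParams nL n} {g : Fin T → Fin n → Bool}
  {z w : Fin T → Fin (nL + 1)} {b e η N : ℝ}

/-- The matrix of the model with entries in the unit interval. -/
def HubParams.prob (P : HubParams nL n) : Fin (nL + 1) → Fin n → I := unitMatrix P.A_mem

/-- No group is labelled by a leader that is absent from it. -/
def Feasible (h : nL ≤ n) (g : Fin T → Fin n → Bool) (w : Fin T → Fin (nL + 1)) : Prop :=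
  ∀ t k, w t = Fin.succ k → g t (hubNode h k) = true

-- Feasibility puts the leader of the dominant label `c` into almost all groups labelled `a`,
-- whereas it appears in a proportion of about `P.A a c ≤ b` of them.
lemma HubParams.CrossLE.eq_of_dominant (hcross : P.CrossLE b) (htyp : IsTypical P.prob N e g z)
    (hfeas : Feasible P.le g w) (hN : 0 < N) (he : 0 ≤ e) (heb : 2 * e < 1 - b) (hη : 0 ≤ η)
    (hηN : (nL + 1) * η ≤ e * N) {a : Fin (nL + 1)} {k : Fin nL}
    (hdom : ∀ c, c ≠ k.succ → confusion z w a c ≤ η) : a = k.succ := by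
  by_contra hne
  have hcount : 0 < (labelCount z a : ℝ) := hN.trans_le (htyp.le_labelCount a)
  have hpresence : (labelCount z a : ℝ) ≤ presence g z a (hubNode P.le k) + e * N := by
    have hstray := card_label_ne_le hη hdom
    have hhub : (confusion z w a k.succ : ℝ) ≤ presence g z a (hubNode P.le k) :=
      mod_cast confusion_le_presence (hfeas · k) a
    rw [Fintype.card_fin, Nat.cast_add_one] at hstray
    rw [labelCount_eq_confusion_add z w a k.succ, Nat.cast_add]
    linarith
  have hfreq : (presence g z a (hubNode P.le k) : ℝ) ≤ (b + e) * labelCount z a := by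
    rw [← div_le_iff₀ hcount]
    have hclose := (abs_le.1 (htyp.abs_freq_sub_le a (hubNode P.le k))).2
    have hb := hcross a k hne
    simp only [freq, HubParams.prob, unitMatrix] at hclose
    linarith
  have heN : e * N ≤ e * labelCount z a := by gcongr; exact htyp.le_labelCount a
  nlinarith

lemma HubParams.CrossLE.confusion_le (hcross : P.CrossLE b) (htyp : IsTypical P.prob N e g z)
    (hfeas : Feasible P.le g w) (hN : 0 < N) (he : 0 ≤ e) (he1 : e < 1) (heb : 2 * e < 1 - b)
    (hη : 0 ≤ η) (hηN : (nL + 1) * η ≤ e * N) (hmix : ¬ Mixes η z w) :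
    ∀ a c, c ≠ a → (confusion z w a c : ℝ) ≤ η := by
  obtain ⟨ψ, hψ⟩ := exists_perm_confusion_le hmix fun a => by
    rw [Fintype.card_fin, Nat.cast_add_one]
    nlinarith [htyp.le_labelCount a]
  have hleader : ∀ a k, ψ a = Fin.succ k → a = ψ a := fun a k hk =>
    (hcross.eq_of_dominant htyp hfeas hN he heb hη hηN (hk ▸ hψ a)).trans hk.symm
  have hnull : ψ 0 = 0 := by
    rcases Fin.eq_zero_or_eq_succ (ψ 0) with h | ⟨k, hk⟩
    · exact h
    · exact (hleader 0 k hk).symm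
  have hid : ∀ a, ψ a = a := fun a => by
    rcases Fin.eq_zero_or_eq_succ (ψ a) with h | ⟨k, hk⟩
    · rw [h, ψ.injective (h.trans hnull.symm)]
    · exact (hleader a k hk).symm
  exact fun a c hc => hψ a c (by rwa [hid a])

theorem HubParams.CrossLE.maxError_le (hcross : P.CrossLE b) (htyp : IsTypical P.prob N e g z)
    (hfeas : Feasible P.le g w) (hN : 0 < N) (he : 0 ≤ e) (he1 : e < 1) (heb : 2 * e < 1 - b)
    (hη : 0 ≤ η) (hηN : (nL + 1) * η ≤ e * N) (hmix : ¬ Mixes η z w) :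
    maxError P g w ≤ 3 * e := by
  refine Real.iSup_le (fun ⟨a, j⟩ => ?_) (by positivity)
  have hcount : 0 < (labelCount z a : ℝ) := hN.trans_le (htyp.le_labelCount a)
  have hrelabel : |(freq g w a j : ℝ) - freq g z a j| ≤ 2 * e := by
    refine (abs_freq_sub_freq_le g hη (mod_cast hcount)
      (hcross.confusion_le htyp hfeas hN he he1 heb hη hηN hmix) j).trans ?_
    rw [div_le_iff₀ hcount, Fintype.card_fin, Nat.cast_add_one]
    nlinarith [htyp.le_labelCount a]
  calc |Ahat g w a j - P.A a j| = |((freq g w a j : ℝ) - freq g z a j)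
          + (freq g z a j - P.prob a j)| := by rw [Ahat_eq_freq, sub_add_sub_cancel]; rfl
    _ ≤ 2 * e + e := (abs_add_le _ _).trans (add_le_add hrelabel (htyp.abs_freq_sub_le a j))
    _ = 3 * e := by ring

lemma HubParams.CrossLE.maxError_le_of_isInformative (hcross : P.CrossLE b)
    (hinf : IsInformative P.prob N e η g z) (hw : IsMaxProfile P.le g w) (hN : 0 < N) (he : 0 ≤ e)
    (he1 : e < 1) (heb : 2 * e < 1 - b) (hη : 0 ≤ η) (hηN : (nL + 1) * η ≤ e * N) :
    maxError P g w ≤ 3 * e :=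
  hcross.maxError_le hinf.toIsTypical (fun _ _ => hw.hub_mem P.A_mem hinf.lik_pos) hN he he1 heb hη
    hηN fun hmix => (hinf.lik_lt w hmix).not_ge (hw.lik_le P.A_mem z)

end Recovery

section Hoeffding

lemma measureReal_abs_ge_le_of_hasSubgaussianMGF {Ω : Type*} [MeasurableSpace Ω] {μ : Measure Ω}
    [IsFiniteMeasure μ] {X : Ω → ℝ} {c : NNReal} (hX : HasSubgaussianMGF X c μ) {ε : ℝ}
    (hε : 0 ≤ ε) : μ.real {ω | ε ≤ |X ω|} ≤ 2 * Real.exp (-ε ^ 2 / (2 * c)) :=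
  calc μ.real {ω | ε ≤ |X ω|} = μ.real ({ω | ε ≤ X ω} ∪ {ω | ε ≤ (-X) ω}) := by
        simp only [le_abs, Set.ofPred_or, Pi.neg_apply]
    _ ≤ μ.real {ω | ε ≤ X ω} + μ.real {ω | ε ≤ (-X) ω} := measureReal_union_le _ _
    _ ≤ 2 * Real.exp (-ε ^ 2 / (2 * c)) := by
        linarith [hX.measure_ge_le hε, hX.neg.measure_ge_le hε]

variable {ι : Type*} [Fintype ι] {X : ι → Type*} [∀ i, MeasurableSpace (X i)]
  (μ : ∀ i, Measure (X i)) [∀ i, IsProbabilityMeasure (μ i)] {f : ∀ i, X i → ℝ}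

lemma hasSubgaussianMGF_pi_sum_sub_integral (hf : ∀ i, Measurable (f i))
    (hf01 : ∀ i x, f i x ∈ Set.Icc (0 : ℝ) 1) (s : Finset ι) :
    HasSubgaussianMGF (fun x => ∑ i ∈ s, (f i (x i) - ∫ y, f i y ∂μ i)) (s.card / 4)
      (Measure.pi μ) := by
  have hsubG : ∀ i ∈ s, HasSubgaussianMGF (fun x => f i (x i) - ∫ y, f i y ∂μ i)
      ((‖(1 : ℝ) - 0‖₊ / 2) ^ 2) (Measure.pi μ) := fun i _ => by
    rw [← integral_comp_eval (μ := μ) (hf i).aestronglyMeasurable]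
    exact hasSubgaussianMGF_of_mem_Icc ((hf i).comp (measurable_pi_apply i)).aemeasurable
      (ae_of_all _ fun x => hf01 i (x i))
  have hindep : iIndepFun (fun i x => f i (x i) - ∫ y, f i y ∂μ i) (Measure.pi μ) :=
    iIndepFun_pi fun i => ((hf i).sub_const _).aemeasurable
  convert HasSubgaussianMGF.sum_of_iIndepFun hindep hsubG using 1
  norm_num [div_eq_mul_inv]

lemma measureReal_pi_abs_sum_sub_integral_ge_le (hf : ∀ i, Measurable (f i))
    (hf01 : ∀ i x, f i x ∈ Set.Icc (0 : ℝ) 1) (s : Finset ι) {ε : ℝ} (hε : 0 ≤ ε) :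
    (Measure.pi μ).real {x | ε ≤ |∑ i ∈ s, (f i (x i) - ∫ y, f i y ∂μ i)|} ≤
      2 * Real.exp (-2 * ε ^ 2 / s.card) := by
  convert measureReal_abs_ge_le_of_hasSubgaussianMGF
    (hasSubgaussianMGF_pi_sum_sub_integral μ hf hf01 s) hε using 3
  push_cast
  rcases eq_or_ne (s.card : ℝ) 0 with hs | hs
  · simp [hs]
  · field_simp
    ring

end Hoeffding

lemma bernoulliMeasure_real_singleton (p : I) (b : Bool) :
    (bernoulliMeasure true false p).real {b} = bern p b := by
  cases b <;> simp [bern]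

lemma bhattacharyya_le (p q : I) :
    ∑ b, √(bern p b * bern q b) ≤ Real.exp (-((p - q : ℝ) ^ 2 / 2)) := by
  simp only [Fintype.sum_bool, bern, if_true, Bool.false_eq_true, if_false]
  obtain ⟨p, hp0, hp1⟩ := p
  obtain ⟨q, hq0, hq1⟩ := q
  have : 0 ≤ 1 - p := sub_nonneg.2 hp1
  have : 0 ≤ 1 - q := sub_nonneg.2 hq1
  set a := √(p * (1 - q))
  set b := √(q * (1 - p))
  set c := √(p * q)
  set e := √((1 - p) * (1 - q))
  have ha : a ^ 2 = p * (1 - q) := Real.sq_sqrt (by positivity)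
  have hb : b ^ 2 = q * (1 - p) := Real.sq_sqrt (by positivity)
  have hc : c ^ 2 = p * q := Real.sq_sqrt (by positivity)
  have he : e ^ 2 = (1 - p) * (1 - q) := Real.sq_sqrt (by positivity)
  have hab : a * b = c * e := by
    rw [← Real.sqrt_mul (by positivity), ← Real.sqrt_mul (by positivity)]
    congr 1
    ring
  have hab1 : (a + b) ^ 2 ≤ 1 := by nlinarith [sq_nonneg (c - e)]
  have hpq : p - q = (a - b) * (a + b) := by linear_combination hb - ha
  have hsq : (c + e) ^ 2 = 1 - (a - b) ^ 2 := by linear_combination hc + he + ha + hb - 2 * hab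
  have hgap : (p - q) ^ 2 ≤ 1 - (c + e) ^ 2 := by
    rw [hsq, hpq, mul_pow]
    nlinarith [sq_nonneg (a - b)]
  have hcoef : c + e ≤ 1 - (p - q) ^ 2 / 2 := by nlinarith [sq_nonneg (c + e - 1)]
  linarith [Real.add_one_le_exp (-((p - q) ^ 2 / 2))]

section DataLaw

variable {τ κ ν : Type*} [Fintype τ] [Fintype ν]

/-- The law of the data given the labels `z`: the node `j` appears in the group `t` with
probability `A (z t) j`, independently for all `t` and `j`. -/
noncomputable def dataLaw (A : κ → ν → I) (z : τ → κ) : Measure (τ → ν → Bool) :=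
  Measure.pi fun t => Measure.pi fun j => bernoulliMeasure true false (A (z t) j)

instance (A : κ → ν → I) (z : τ → κ) : IsProbabilityMeasure (dataLaw A z) := by
  unfold dataLaw
  infer_instance

lemma dataLaw_real_singleton (A : κ → ν → I) (z : τ → κ) (g : τ → ν → Bool) :
    (dataLaw A z).real {g} = lik g A z := by
  simp only [dataLaw, measureReal_def, Measure.pi_singleton, ENNReal.toReal_prod, lik,
    ← bernoulliMeasure_real_singleton]

lemma dataLaw_real_lik_eq_zero (A : κ → ν → I) (z : τ → κ) :
    (dataLaw A z).real {g | lik g A z = 0} = 0 := by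
  classical
  rw [← Finset.coe_filter_univ, ← sum_measureReal_singleton]
  exact Finset.sum_eq_zero fun g hg =>
    (dataLaw_real_singleton A z g).trans (Finset.mem_filter.1 hg).2

lemma sum_sqrt_lik_mul_lik [DecidableEq τ] [DecidableEq ν] (A B : κ → ν → I) (z w : τ → κ) :
    ∑ g, √(lik g A z * lik g B w) =
      ∏ t, ∏ j, ∑ b, √(bern (A (z t) j) b * bern (B (w t) j) b) := by
  have hsqrt (g : τ → ν → Bool) : √(lik g A z * lik g B w) =
      ∏ t, ∏ j, √(bern (A (z t) j) (g t j) * bern (B (w t) j) (g t j)) := by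
    have hb (t j) := mul_nonneg (bern_nonneg (A (z t) j) (g t j)) (bern_nonneg (B (w t) j) (g t j))
    simp only [lik, ← Finset.prod_mul_distrib]
    rw [Real.sqrt_prod _ fun t _ => Finset.prod_nonneg fun j _ => hb t j]
    exact Finset.prod_congr rfl fun t _ => Real.sqrt_prod _ fun j _ => hb t j
  simp only [hsqrt, Fintype.prod_sum]

theorem dataLaw_real_lik_le_lik_le (A B : κ → ν → I) (z w : τ → κ) :
    (dataLaw A z).real {g | lik g A z ≤ lik g B w} ≤
      Real.exp (-∑ t, ∑ j, (A (z t) j - B (w t) j : ℝ) ^ 2 / 2) := by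
  classical
  calc (dataLaw A z).real {g | lik g A z ≤ lik g B w}
      = ∑ g with lik g A z ≤ lik g B w, lik g A z := by
        simp only [← dataLaw_real_singleton, sum_measureReal_singleton, Finset.coe_filter_univ]
    _ ≤ ∑ g with lik g A z ≤ lik g B w, √(lik g A z * lik g B w) := by
        refine Finset.sum_le_sum fun g hg => Real.le_sqrt_of_sq_le ?_
        rw [sq]
        exact mul_le_mul_of_nonneg_left (Finset.mem_filter.1 hg).2 (lik_nonneg g A z)
    _ ≤ ∑ g, √(lik g A z * lik g B w) :=
        Finset.sum_le_sum_of_subset_of_nonneg (Finset.filter_subset _ _)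
          fun _ _ _ => Real.sqrt_nonneg _
    _ ≤ ∏ t, ∏ j, Real.exp (-((A (z t) j - B (w t) j : ℝ) ^ 2 / 2)) := by
        rw [sum_sqrt_lik_mul_lik]
        exact Finset.prod_le_prod (fun t _ => Finset.prod_nonneg fun j _ => by positivity)
          fun t _ => Finset.prod_le_prod (fun j _ => by positivity) fun j _ =>
            bhattacharyya_le _ _
    _ = _ := by simp only [← Real.exp_sum, Finset.sum_neg_distrib]

lemma integral_ite_appears (p : ν → I) (j : ν) :
    ∫ x, (if x j = true then (1 : ℝ) else 0)
      ∂Measure.pi (fun j => bernoulliMeasure true false (p j)) = p j := by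
  rw [integral_comp_eval (X := fun _ => Bool) (f := fun b => if b = true then (1 : ℝ) else 0)
    (measurable_of_finite _).aestronglyMeasurable, integral_bernoulliMeasure]
  simp

theorem dataLaw_real_le_abs_freq_sub_le [DecidableEq κ] (A : κ → ν → I) {z : τ → κ} {a : κ}
    {N e : ℝ} (hN : 0 < N) (he : 0 ≤ e) (ha : N ≤ labelCount z a) (j : ν) :
    (dataLaw A z).real {g | e ≤ |(freq g z a j : ℝ) - A a j|} ≤
      2 * Real.exp (-2 * e ^ 2 * N) := by
  have hcount : 0 < (labelCount z a : ℝ) := hN.trans_le ha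
  have hhoeffding := measureReal_pi_abs_sum_sub_integral_ge_le
    (fun t => Measure.pi fun j => bernoulliMeasure true false (A (z t) j))
    (f := fun _ x => if x j = true then (1 : ℝ) else 0) (fun _ => measurable_of_finite _)
    (fun _ x => by split_ifs <;> simp) (Finset.univ.filter (z · = a))
    (mul_nonneg hcount.le he)
  simp only [integral_ite_appears, sum_ite_appears_sub A _ (Nat.cast_pos.1 hcount).ne', abs_mul,
    abs_of_pos hcount, mul_le_mul_iff_right₀ hcount] at hhoeffding
  refine hhoeffding.trans (mul_le_mul_of_nonneg_left (Real.exp_le_exp.2 ?_) zero_le_two)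
  calc -2 * (labelCount z a * e) ^ 2 / labelCount z a = -2 * e ^ 2 * labelCount z a := by
        field_simp
    _ ≤ -2 * e ^ 2 * N := by nlinarith [sq_nonneg e]

end DataLaw

section Mixing

variable {τ κ ν : Type*} [Fintype τ] [DecidableEq κ]

lemma confusion_mul_sum_sq_add_le_sum_sq [Fintype ν] (A B : κ → ν → I) (z w : τ → κ) {a a' : κ}
    (hne : a ≠ a') (b : κ) :
    confusion z w a b * ∑ j, (A a j - B b j : ℝ) ^ 2 +
      confusion z w a' b * ∑ j, (A a' j - B b j : ℝ) ^ 2 ≤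
      ∑ t, ∑ j, (A (z t) j - B (w t) j : ℝ) ^ 2 := by
  classical
  have hblock (a : κ) : confusion z w a b * ∑ j, (A a j - B b j : ℝ) ^ 2 =
      ∑ t with z t = a ∧ w t = b, ∑ j, (A (z t) j - B (w t) j : ℝ) ^ 2 := by
    rw [← nsmul_eq_mul]
    refine (Finset.sum_eq_card_nsmul fun t ht => ?_).symm
    rw [(Finset.mem_filter.1 ht).2.1, (Finset.mem_filter.1 ht).2.2]
  have hdisj : Disjoint (Finset.univ.filter fun t => z t = a ∧ w t = b)
      (Finset.univ.filter fun t => z t = a' ∧ w t = b) :=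
    Finset.disjoint_filter.2 fun t _ h h' => hne (h.1.symm.trans h'.1)
  rw [hblock, hblock, ← Finset.sum_union hdisj]
  exact Finset.sum_le_sum_of_subset_of_nonneg (Finset.subset_univ _)
    fun _ _ _ => Finset.sum_nonneg fun _ _ => sq_nonneg _

-- No row of `B` can be close to both of the rows `a` and `a'` of `A` that its label mixes.
lemma Mixes.le_sum_sq [Fintype ν] {A : κ → ν → I} {s η : ℝ} {z w : τ → κ}
    (hsep : ∀ a a', a ≠ a' → s ≤ ∑ j, (A a j - A a' j : ℝ) ^ 2) (hη : 0 ≤ η) (h : Mixes η z w)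
    (B : κ → ν → I) : η * s / 2 ≤ ∑ t, ∑ j, (A (z t) j - B (w t) j : ℝ) ^ 2 := by
  obtain ⟨b, a, a', hne, ha, ha'⟩ := h
  set D : κ → ℝ := fun a => ∑ j, (A a j - B b j : ℝ) ^ 2
  have hD (a : κ) : 0 ≤ D a := Finset.sum_nonneg fun _ _ => sq_nonneg _
  have hparallelogram : s ≤ 2 * (D a + D a') := by
    refine (hsep a a' hne).trans ?_
    rw [← Finset.sum_add_distrib, Finset.mul_sum]
    exact Finset.sum_le_sum fun j _ => by
      linarith [sq_nonneg ((A a j - B b j : ℝ) + (A a' j - B b j))]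
  calc η * s / 2 ≤ η * D a + η * D a' := by linarith [mul_le_mul_of_nonneg_left hparallelogram hη]
    _ ≤ confusion z w a b * D a + confusion z w a' b * D a' :=
      add_le_add (mul_le_mul_of_nonneg_right ha (hD a)) (mul_le_mul_of_nonneg_right ha' (hD a'))
    _ ≤ _ := confusion_mul_sum_sq_add_le_sum_sq A B z w hne b

/-- The frequencies with numerators `m` for the labels `w`. The frequencies of all data range over
these finitely many matrices; numerators exceeding `labelCount` are clamped. -/
noncomputable def gridFreq (w : τ → κ) (m : κ → ν → Fin (Fintype.card τ + 1)) : κ → ν → I :=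
  fun a j => Set.projIcc 0 1 zero_le_one ((m a j : ℝ) / labelCount w a)

lemma exists_gridFreq_eq_freq (g : τ → ν → Bool) (w : τ → κ) : ∃ m, gridFreq w m = freq g w := by
  refine ⟨fun a j => ⟨presence g w a j, Nat.lt_succ_of_le (Finset.card_le_univ _)⟩, ?_⟩
  ext a j
  exact congrArg Subtype.val (Set.projIcc_val zero_le_one (freq g w a j))

variable [Fintype κ] [Fintype ν] {A : κ → ν → I} {s η : ℝ}

theorem dataLaw_real_exists_mixes_le (hsep : ∀ a a', a ≠ a' → s ≤ ∑ j, (A a j - A a' j : ℝ) ^ 2)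
    (hη : 0 ≤ η) (z : τ → κ) :
    (dataLaw A z).real {g | ∃ w, Mixes η z w ∧ lik g A z ≤ lik g (freq g w) w} ≤
      (Fintype.card κ : ℝ) ^ Fintype.card τ *
        (Fintype.card τ + 1) ^ (Fintype.card κ * Fintype.card ν) * Real.exp (-(η * s / 4)) := by
  classical
  set E : (τ → κ) × (κ → ν → Fin (Fintype.card τ + 1)) → Set (τ → ν → Bool) :=
    fun c => {g | Mixes η z c.1 ∧ lik g A z ≤ lik g (gridFreq c.1 c.2) c.1}
  have hE (c) : (dataLaw A z).real (E c) ≤ Real.exp (-(η * s / 4)) := by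
    by_cases hc : Mixes η z c.1
    · simp only [E, hc, true_and]
      refine (dataLaw_real_lik_le_lik_le A _ z c.1).trans (Real.exp_le_exp.2 (neg_le_neg ?_))
      simp only [← Finset.sum_div]
      linarith [hc.le_sum_sq hsep hη (gridFreq c.1 c.2)]
    · simp only [E, hc, false_and, Set.ofPred_false, measureReal_empty]
      positivity
  calc (dataLaw A z).real {g | ∃ w, Mixes η z w ∧ lik g A z ≤ lik g (freq g w) w}
      ≤ (dataLaw A z).real (⋃ c, E c) := by
        refine measureReal_mono fun g ⟨w, hw, hle⟩ => ?_
        obtain ⟨m, hm⟩ := exists_gridFreq_eq_freq g w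
        exact Set.mem_iUnion.2 ⟨(w, m), hw, hm ▸ hle⟩
    _ ≤ ∑ c, (dataLaw A z).real (E c) := measureReal_iUnion_fintype_le _
    _ ≤ Fintype.card ((τ → κ) × (κ → ν → Fin (Fintype.card τ + 1))) * Real.exp (-(η * s / 4)) :=
        (Finset.sum_le_card_nsmul _ _ _ fun c _ => hE c).trans_eq (nsmul_eq_mul _ _)
    _ = _ := by
        simp only [Fintype.card_prod, Fintype.card_fun, Fintype.card_fin]
        push_cast
        rw [← pow_mul, mul_comm (Fintype.card ν)]

end Mixing

section Typical

variable {τ κ ν : Type*} [Fintype τ] [Fintype κ] [Fintype ν] [DecidableEq κ] {A : κ → ν → I}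

theorem dataLaw_real_not_isTypical_le {z : τ → κ} {N e : ℝ} (hN : 0 < N) (he : 0 ≤ e)
    (hz : ∀ a, N ≤ labelCount z a) :
    (dataLaw A z).real {g | ¬ IsTypical A N e g z} ≤
      Fintype.card κ * Fintype.card ν * (2 * Real.exp (-2 * e ^ 2 * N)) :=
  calc (dataLaw A z).real {g | ¬ IsTypical A N e g z}
      ≤ (dataLaw A z).real
          (⋃ c : κ × ν, {g | e ≤ |(freq g z c.1 c.2 : ℝ) - A c.1 c.2|}) := by
        refine measureReal_mono fun g hg => ?_
        by_contra hc
        simp only [Set.mem_iUnion, not_exists, Prod.forall, Set.mem_ofPred_eq, not_le] at hc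
        exact hg ⟨hz, fun a j => (hc a j).le⟩
    _ ≤ ∑ c : κ × ν, (dataLaw A z).real {g | e ≤ |(freq g z c.1 c.2 : ℝ) - A c.1 c.2|} :=
        measureReal_iUnion_fintype_le _
    _ ≤ Fintype.card (κ × ν) * (2 * Real.exp (-2 * e ^ 2 * N)) :=
        (Finset.sum_le_card_nsmul _ _ _ fun c _ =>
          dataLaw_real_le_abs_freq_sub_le A hN he (hz c.1) c.2).trans_eq (nsmul_eq_mul _ _)
    _ = _ := by rw [Fintype.card_prod, Nat.cast_mul]

theorem dataLaw_real_not_isInformative_le {s η N e : ℝ}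
    (hsep : ∀ a a', a ≠ a' → s ≤ ∑ j, (A a j - A a' j : ℝ) ^ 2) (hN : 0 < N) (he : 0 ≤ e)
    (hη : 0 ≤ η) {z : τ → κ} (hz : ∀ a, N ≤ labelCount z a) :
    (dataLaw A z).real {g | ¬ IsInformative A N e η g z} ≤
      Fintype.card κ * Fintype.card ν * (2 * Real.exp (-2 * e ^ 2 * N)) +
        (Fintype.card κ : ℝ) ^ Fintype.card τ *
          (Fintype.card τ + 1) ^ (Fintype.card κ * Fintype.card ν) * Real.exp (-(η * s / 4)) := by
  have hsubset : {g | ¬ IsInformative A N e η g z} ⊆ {g | ¬ IsTypical A N e g z} ∪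
      {g | ∃ w, Mixes η z w ∧ lik g A z ≤ lik g (freq g w) w} ∪ {g | lik g A z = 0} := by
    intro g hg
    by_contra hc
    simp only [Set.mem_union, Set.mem_ofPred_eq, not_or, not_not, not_exists, not_and,
      not_le] at hc
    exact hg ⟨hc.1.1, (lik_nonneg g A z).lt_of_ne' hc.2, hc.1.2⟩
  refine (measureReal_mono hsubset).trans ((measureReal_union_le _ _).trans ?_)
  rw [dataLaw_real_lik_eq_zero, add_zero]
  exact (measureReal_union_le _ _).trans (add_le_add (dataLaw_real_not_isTypical_le hN he hz)
    (dataLaw_real_exists_mixes_le hsep hη z))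

end Typical

section HubLaw

variable {nL n T : ℕ} {P : HubParams nL n} {b c d v e ε : ℝ}

/-- The law of the label of a group. -/
noncomputable def HubParams.labelLaw (P : HubParams nL n) : Measure (Fin (nL + 1)) :=
  (PMF.ofFintype (fun a => ENNReal.ofReal (P.ρ a)) <| by
    rw [← ENNReal.ofReal_sum_of_nonneg fun a _ => P.ρ_nonneg a, P.ρ_sum,
      ENNReal.ofReal_one]).toMeasure

instance : IsProbabilityMeasure P.labelLaw := by
  unfold HubParams.labelLaw
  infer_instance

lemma labelLaw_singleton (a : Fin (nL + 1)) : P.labelLaw {a} = ENNReal.ofReal (P.ρ a) := by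
  rw [HubParams.labelLaw, PMF.toMeasure_apply_singleton _ _ (measurableSet_singleton a),
    PMF.ofFintype_apply]

lemma pi_labelLaw_real_labelCount_lt_le (hc : 0 ≤ c) {a : Fin (nL + 1)} (ha : c ≤ P.ρ a) :
    (Measure.pi fun _ : Fin T => P.labelLaw).real {z | labelCount z a < c * T / 2} ≤
      2 * Real.exp (-(c ^ 2 * T / 2)) := by
  have hmean : ∫ x, Set.indicator {a} (1 : Fin (nL + 1) → ℝ) x ∂P.labelLaw = P.ρ a := by
    rw [integral_indicator_one (measurableSet_singleton a), measureReal_def, labelLaw_singleton,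
      ENNReal.toReal_ofReal (P.ρ_nonneg a)]
  have hcount (z : Fin T → Fin (nL + 1)) :
      ∑ t, (Set.indicator {a} (1 : Fin (nL + 1) → ℝ) (z t) - P.ρ a) =
        labelCount z a - T * P.ρ a := by
    simp [Set.indicator_apply, labelCount, Finset.sum_boole]
  have hhoeffding := measureReal_pi_abs_sum_sub_integral_ge_le (fun _ : Fin T => P.labelLaw)
    (f := fun _ => Set.indicator {a} 1) (fun _ => measurable_of_finite _)
    (fun _ x => by by_cases hx : x = a <;> simp [hx]) Finset.univ (ε := c * T / 2) (by positivity)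
  simp only [hmean, hcount, Finset.card_univ, Fintype.card_fin] at hhoeffding
  refine (measureReal_mono fun z (hz : labelCount z a < c * T / 2) => ?_).trans
    (hhoeffding.trans_eq ?_)
  · have hρT := mul_le_mul_of_nonneg_left ha (Nat.cast_nonneg (α := ℝ) T)
    have hdev : labelCount z a - T * P.ρ a ≤ -(c * T / 2) := by linarith
    exact le_abs'.2 (Or.inl hdev)
  · congr 2
    rcases T.eq_zero_or_pos with rfl | hT
    · simp
    · field_simp

theorem pi_labelLaw_real_exists_labelCount_lt_le (hc : 0 ≤ c) (hρ : ∀ a, c ≤ P.ρ a) :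
    (Measure.pi fun _ : Fin T => P.labelLaw).real {z | ∃ a, labelCount z a < c * T / 2} ≤
      (nL + 1) * (2 * Real.exp (-(c ^ 2 * T / 2))) := by
  rw [Set.ofPred_exists]
  refine (measureReal_iUnion_fintype_le _).trans <| (Finset.sum_le_card_nsmul _ _ _ fun a _ =>
    pi_labelLaw_real_labelCount_lt_le hc (hρ a)).trans_eq ?_
  rw [nsmul_eq_mul, Finset.card_univ, Fintype.card_fin, Nat.cast_add_one]

lemma HubParams.Separated.le_sum_sq_succ (hsep : P.Separated d v) (hd : 0 ≤ d) (hv : 0 ≤ v)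
    {k : Fin nL} {i : Fin (nL + 1)} (hi : i ≠ k.succ) :
    v * n / (nL + 1) * d ^ 2 ≤ ∑ j, (P.prob k.succ j - P.prob i j : ℝ) ^ 2 := by
  obtain ⟨V, hV⟩ := hsep
  have hnL : (0 : ℝ) < nL := by exact_mod_cast k.pos
  calc v * n / (nL + 1) * d ^ 2 ≤ ((V k).card : ℝ) * d ^ 2 := by
        gcongr
        exact (div_le_div_of_nonneg_left (by positivity) hnL (by linarith)).trans (hV k).1
    _ = ∑ _j ∈ V k, d ^ 2 := by rw [Finset.sum_const, nsmul_eq_mul]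
    _ ≤ ∑ j ∈ V k, (P.prob k.succ j - P.prob i j : ℝ) ^ 2 :=
        Finset.sum_le_sum fun j hj => pow_le_pow_left₀ hd ((hV k).2 j hj i hi) 2
    _ ≤ ∑ j, (P.prob k.succ j - P.prob i j : ℝ) ^ 2 :=
        Finset.sum_le_sum_of_subset_of_nonneg (Finset.subset_univ _) fun _ _ _ => sq_nonneg _

lemma HubParams.Separated.le_sum_sq (hsep : P.Separated d v) (hd : 0 ≤ d) (hv : 0 ≤ v)
    (a a' : Fin (nL + 1)) (hne : a ≠ a') :
    v * n / (nL + 1) * d ^ 2 ≤ ∑ j, (P.prob a j - P.prob a' j : ℝ) ^ 2 := by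
  cases a using Fin.cases with
  | succ k => exact hsep.le_sum_sq_succ hd hv hne.symm
  | zero =>
    obtain ⟨k, rfl⟩ := Fin.exists_succ_eq.2 hne.symm
    simpa only [sub_sq_comm] using hsep.le_sum_sq_succ hd hv hne

variable {Ω : Type*} [MeasurableSpace Ω] {μ : Measure Ω} {zstar : Ω → Fin T → Fin (nL + 1)}
  {G : Ω → Fin T → Fin n → Bool}

lemma IsHubSample.measure_eq_mul (h : IsHubSample P μ zstar G) (z : Fin T → Fin (nL + 1))
    (g : Fin T → Fin n → Bool) :
    μ {ω | zstar ω = z ∧ G ω = g} =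
      (Measure.pi fun _ => P.labelLaw) {z} * dataLaw P.prob z {g} := by
  rw [h.law, Measure.pi_singleton, ← ofReal_measureReal (μ := dataLaw P.prob z),
    dataLaw_real_singleton, Finset.prod_mul_distrib, ENNReal.ofReal_mul
      (Finset.prod_nonneg fun t _ => P.ρ_nonneg (z t)),
    ENNReal.ofReal_prod_of_nonneg fun t _ => P.ρ_nonneg (z t)]
  simp only [labelLaw_singleton]
  rfl

theorem IsHubSample.measure_mem_eq_lintegral (h : IsHubSample P μ zstar G)
    (S : Set ((Fin T → Fin (nL + 1)) × (Fin T → Fin n → Bool))) :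
    μ {ω | (zstar ω, G ω) ∈ S} =
      ∫⁻ z, dataLaw P.prob z {g | (z, g) ∈ S} ∂(Measure.pi fun _ => P.labelLaw) := by
  let κ : Kernel (Fin T → Fin (nL + 1)) (Fin T → Fin n → Bool) :=
    Kernel.ofFunOfCountable (dataLaw P.prob)
  have : IsMarkovKernel κ := ⟨fun z => inferInstanceAs (IsProbabilityMeasure (dataLaw P.prob z))⟩
  have hmeas : Measurable fun ω => (zstar ω, G ω) := h.measurable_zstar.prodMk h.measurable_G
  have hlaw : μ.map (fun ω => (zstar ω, G ω)) = (Measure.pi fun _ => P.labelLaw) ⊗ₘ κ := by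
    refine Measure.ext_of_singleton fun ⟨z, g⟩ => ?_
    rw [Measure.map_apply hmeas (measurableSet_singleton _), ← Set.singleton_prod_singleton,
      Measure.compProd_apply_prod (measurableSet_singleton _) (measurableSet_singleton _),
      lintegral_singleton, mul_comm]
    exact h.measure_eq_mul z g
  have hS : MeasurableSet S := S.toFinite.measurableSet
  exact (Measure.map_apply hmeas hS).symm.trans (hlaw ▸ Measure.compProd_apply hS)

lemma IsHubSample.measure_mem_le (h : IsHubSample P μ zstar G)
    {S : Set ((Fin T → Fin (nL + 1)) × (Fin T → Fin n → Bool))} {Q : Set (Fin T → Fin (nL + 1))}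
    {p q : ℝ} (hQ : (Measure.pi fun _ => P.labelLaw).real Qᶜ ≤ p) (hq : 0 ≤ q)
    (hS : ∀ z ∈ Q, (dataLaw P.prob z).real {g | (z, g) ∈ S} ≤ q) :
    μ {ω | (zstar ω, G ω) ∈ S} ≤ ENNReal.ofReal (p + q) := by
  set Λ := Measure.pi fun _ : Fin T => P.labelLaw
  have hbound (z) : dataLaw P.prob z {g | (z, g) ∈ S} ≤
      Qᶜ.indicator 1 z + ENNReal.ofReal q := by
    by_cases hz : z ∈ Q
    · rw [Set.indicator_of_notMem (Set.notMem_compl_iff.2 hz), zero_add, ← ofReal_measureReal]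
      exact ENNReal.ofReal_le_ofReal (hS z hz)
    · rw [Set.indicator_of_mem hz]
      exact prob_le_one.trans le_self_add
  calc μ {ω | (zstar ω, G ω) ∈ S} = ∫⁻ z, dataLaw P.prob z {g | (z, g) ∈ S} ∂Λ :=
        h.measure_mem_eq_lintegral S
    _ ≤ ∫⁻ z, Qᶜ.indicator 1 z + ENNReal.ofReal q ∂Λ := lintegral_mono hbound
    _ = Λ Qᶜ + ENNReal.ofReal q := by
        rw [lintegral_add_right _ measurable_const,
          lintegral_indicator_one Qᶜ.toFinite.measurableSet, lintegral_const, measure_univ, mul_one]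
    _ ≤ ENNReal.ofReal (p + q) := by
        rw [← ofReal_measureReal, ← ENNReal.ofReal_add measureReal_nonneg hq]
        exact ENNReal.ofReal_le_ofReal (by gcongr)

theorem IsHubSample.measure_maxError_le (h : IsHubSample P μ zstar G)
    {zhat : Ω → Fin T → Fin (nL + 1)} (hzhat : ∀ ω, IsMaxProfile P.le (G ω) (zhat ω))
    (hρ : ∀ a, c ≤ P.ρ a) (hsep : P.Separated d v) (hcross : P.CrossLE b) (hc : 0 < c)
    (hT : 0 < T) (hd : 0 ≤ d) (hv : 0 ≤ v) (he : 0 < e) (he1 : e < 1) (heb : 2 * e < 1 - b)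
    (heε : 3 * e < ε) :
    μ {ω | ε ≤ |maxError P (G ω) (zhat ω)|} ≤ ENNReal.ofReal
      ((nL + 1) * (2 * Real.exp (-(c ^ 2 * T / 2))) +
        ((nL + 1) * n * (2 * Real.exp (-(e ^ 2 * (c * T)))) +
          (nL + 1) ^ T * (T + 1) ^ ((nL + 1) * n) *
            Real.exp (-(e * (c * (d ^ 2 * v) * n * T) / (8 * (nL + 1) ^ 2))))) := by
  set N : ℝ := c * T / 2
  set η : ℝ := e * N / (nL + 1)
  have hN : 0 < N := by positivity
  have hη : 0 ≤ η := by positivity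
  have hηN : (nL + 1) * η = e * N := mul_div_cancel₀ _ (by positivity)
  have hsubset : {ω | ε ≤ |maxError P (G ω) (zhat ω)|} ⊆
      {ω | (zstar ω, G ω) ∈ {x | ¬ IsInformative P.prob N e η x.2 x.1}} := by
    intro ω (hω : ε ≤ |maxError P (G ω) (zhat ω)|) hinf
    have hnonneg : 0 ≤ maxError P (G ω) (zhat ω) := Real.iSup_nonneg fun _ => abs_nonneg _
    rw [abs_of_nonneg hnonneg] at hω
    linarith [hcross.maxError_le_of_isInformative hinf (hzhat ω) hN he.le he1 heb hη hηN.le]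
  refine (measure_mono hsubset).trans (h.measure_mem_le (Q := {z | ∀ a, N ≤ labelCount z a})
    ?_ (by positivity) fun z hz => ?_)
  · simpa only [Set.compl_ofPred, not_forall, not_le] using
      pi_labelLaw_real_exists_labelCount_lt_le hc.le hρ
  · refine (dataLaw_real_not_isInformative_le (hsep.le_sum_sq hd hv) hN he.le hη hz).trans_eq ?_
    simp only [Fintype.card_fin, Nat.cast_add_one]
    congr 4
    · simp only [N]; ring
    · simp only [η, N]; field_simp; ring

end HubLaw

section Asymptotic

variable {α : Type*} {l : Filter α} {a f r : α → ℝ} {C : ℝ}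

lemma isLittleO_of_tendsto_div_zero (hr : ∀ᶠ m in l, r m ≠ 0)
    (h : Tendsto (fun m => a m / r m) l (𝓝 0)) : a =o[l] r :=
  isLittleO_of_tendsto' (hr.mono fun _ hm h0 => absurd h0 hm) h

lemma isEquivalent_add_const (hf : Tendsto f l atTop) (y : ℝ) : (fun m => f m + y) ~[l] f :=
  IsEquivalent.refl.add_isLittleO ((isLittleO_const_id_atTop y).comp_tendsto hf)

lemma isEquivalent_log_add_const (hf : Tendsto f l atTop) (y : ℝ) :
    (fun m => Real.log (f m + y)) ~[l] fun m => Real.log (f m) :=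
  (isEquivalent_add_const hf y).log hf

lemma tendsto_exp_sub_mul (ha : a =o[l] r) (ha1 : ∀ᶠ m in l, 1 ≤ a m) (hr : ∀ᶠ m in l, 0 ≤ r m)
    (hC : 0 < C) : Tendsto (fun m => Real.exp (a m - C * r m)) l (𝓝 0) := by
  have h1a : (fun _ => (1 : ℝ)) =O[l] a := .of_bound' <| ha1.mono fun m h => by
    rw [norm_one]
    exact h.trans (le_abs_self _)
  have hnorm : Tendsto (fun m => ‖r m‖) l atTop :=
    (isLittleO_one_left_iff ℝ).1 (h1a.trans_isLittleO ha)
  have hr' : Tendsto r l atTop :=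
    hnorm.congr' (hr.mono fun m h => Real.norm_of_nonneg h)
  refine Real.tendsto_exp_atBot.comp (tendsto_atBot_mono' _ ?_
    (tendsto_neg_atTop_atBot.comp (hr'.const_mul_atTop (half_pos hC))))
  filter_upwards [ha.bound (half_pos hC), hr] with m ham hrm
  rw [Real.norm_of_nonneg hrm] at ham
  have := (le_abs_self _).trans ham
  simp only [Function.comp_apply]
  linarith

lemma sq_mul_log_isLittleO {K N u : α → ℝ} (hK : Tendsto K l atTop) (hN : Tendsto N l atTop)
    (h : (fun m => K m ^ 8 * Real.log (K m)) =o[l] fun m => u m ^ 2 * N m) :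
    (fun m => K m ^ 2 * Real.log (K m)) =o[l] fun m => u m * N m / K m := by
  have hlog : (fun m => Real.log (K m)) =O[l] fun m => K m ^ 2 :=
    ((Real.isLittleO_log_id_atTop.trans
      ((isLittleO_pow_pow_atTop_of_lt one_lt_two).congr_left pow_one)).comp_tendsto hK).isBigO
  have hN1 : (fun _ => (1 : ℝ)) =O[l] N := ((isLittleO_const_id_atTop 1).comp_tendsto hN).isBigO
  refine IsLittleO.of_pow (n := 2) ?_ two_ne_zero
  have hsq : (fun m => (K m ^ 2 * Real.log (K m)) ^ 2) =O[l]
      fun m => K m ^ 8 * Real.log (K m) * (K m ^ 2)⁻¹ := by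
    refine ((isBigO_refl (fun m => K m ^ 4 * Real.log (K m)) l).mul hlog).congr' ?_ ?_
    · exact .of_forall fun m => by ring
    · filter_upwards [hK.eventually_ne_atTop 0] with m hm
      field_simp
  refine hsq.trans_isLittleO
    (((h.mul_isBigO hN1).mul_isBigO (isBigO_refl (fun m => (K m ^ 2)⁻¹) l)).congr ?_ ?_)
  · exact fun m => by rw [mul_one]
  · exact fun m => by simp only [Pi.pow_apply]; ring

end Asymptotic

/-- The growth conditions under which the maximum profile likelihood estimator is consistent, for
`k` leaders, `n` nodes, `T` groups, label probabilities at least `c` and signal `u = d ^ 2 * v`.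
The summand `2` in the first logarithm forces `c ^ 2 * T → ∞` even when `k` stays bounded. -/
structure ConsistencyRates (k n T : ℕ → ℕ) (c u : ℕ → ℝ) : Prop where
  tendsto_nodes : Tendsto n atTop atTop
  tendsto_groups : Tendsto T atTop atTop
  eventually_pos : ∀ᶠ m in atTop, 0 < c m
  log_labels : (fun m => Real.log (k m + 2)) =o[atTop] fun m => c m ^ 2 * T m
  log_nodes : (fun m => Real.log (n m)) =o[atTop] fun m => c m * T m
  sq_mul_log_labels : (fun m => ((k m : ℝ) + 1) ^ 2 * Real.log (k m + 1)) =o[atTop]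
    fun m => c m * u m * n m
  cube_mul_log_groups : (fun m => ((k m : ℝ) + 1) ^ 3 * Real.log (T m)) =o[atTop]
    fun m => c m * u m * T m

namespace ConsistencyRates

variable {k n T : ℕ → ℕ} {c u : ℕ → ℝ} {C : ℝ}

lemma tendsto_label_term (h : ConsistencyRates k n T c u) :
    Tendsto (fun m => ((k m : ℝ) + 1) * (2 * Real.exp (-(c m ^ 2 * T m / 2)))) atTop (𝓝 0) := by
  have hlog (m) : 1 ≤ 2 * Real.log (k m + 2) := by
    have := Real.log_le_log two_pos (le_add_of_nonneg_left (k m).cast_nonneg)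
    linarith [Real.log_two_gt_d9]
  have hexp := (tendsto_exp_sub_mul (h.log_labels.const_mul_left 2) (.of_forall hlog)
    (.of_forall fun m => by positivity) one_half_pos).const_mul 2
  rw [mul_zero] at hexp
  refine squeeze_zero (fun m => by positivity) (fun m => ?_) hexp
  have hexp2 : Real.exp (2 * Real.log (k m + 2)) = (k m + 2 : ℝ) ^ 2 := by
    rw [← Real.exp_log (by positivity : (0 : ℝ) < k m + 2), ← Real.exp_nat_mul, Real.log_exp,
      Nat.cast_ofNat]
  calc ((k m : ℝ) + 1) * (2 * Real.exp (-(c m ^ 2 * T m / 2)))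
      ≤ (k m + 2) ^ 2 * (2 * Real.exp (-(c m ^ 2 * T m / 2))) := by gcongr; nlinarith
    _ = _ := by rw [sub_eq_add_neg, Real.exp_add, hexp2]; ring_nf

lemma tendsto_frequency_term (h : ConsistencyRates k n T c u) (hkn : ∀ m, k m ≤ n m) (hC : 0 < C) :
    Tendsto (fun m => ((k m : ℝ) + 1) * n m * (2 * Real.exp (-(C * (c m * T m))))) atTop (𝓝 0) := by
  have hlog := tendsto_natCast_atTop_atTop.comp h.tendsto_nodes |> Real.tendsto_log_atTop.comp
  have hexp := (tendsto_exp_sub_mul (h.log_nodes.const_mul_left 3) (l := atTop)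
    ((hlog.eventually_ge_atTop 1).mono fun m (hm : 1 ≤ Real.log (n m)) => by linarith)
    (h.eventually_pos.mono fun m hm => by positivity) hC).const_mul 2
  rw [mul_zero] at hexp
  refine squeeze_zero' (.of_forall fun m => by positivity) ?_ hexp
  filter_upwards [h.tendsto_nodes.eventually_ge_atTop 2] with m hm
  have hn2 : (2 : ℝ) ≤ n m := by exact_mod_cast hm
  have hkn' : (k m : ℝ) ≤ n m := by exact_mod_cast hkn m
  have hcube : ((k m : ℝ) + 1) * n m ≤ (n m : ℝ) ^ 3 := by
    rw [pow_succ]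
    gcongr
    nlinarith
  have hexp3 : Real.exp (3 * Real.log (n m)) = (n m : ℝ) ^ 3 := by
    rw [← Nat.cast_ofNat, Real.exp_nat_mul, Real.exp_log (by linarith)]
  calc ((k m : ℝ) + 1) * n m * (2 * Real.exp (-(C * (c m * T m))))
      ≤ (n m : ℝ) ^ 3 * (2 * Real.exp (-(C * (c m * T m)))) := by gcongr
    _ = _ := by rw [sub_eq_add_neg, Real.exp_add, hexp3]; ring

lemma tendsto_mixing_term (h : ConsistencyRates k n T c u) (hu : ∀ m, 0 ≤ u m) (hC : 0 < C) :
    Tendsto (fun m => ((k m : ℝ) + 1) ^ T m * (T m + 1) ^ ((k m + 1) * n m) *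
      Real.exp (-(C * (c m * u m * n m * T m) / (8 * (k m + 1) ^ 2)))) atTop (𝓝 0) := by
  set r : ℕ → ℝ := fun m => c m * u m * n m * T m / (k m + 1) ^ 2
  have hT : Tendsto (fun m => (T m : ℝ)) atTop atTop :=
    tendsto_natCast_atTop_atTop.comp h.tendsto_groups
  have hlabelings : (fun m => T m * Real.log (k m + 1)) =o[atTop] r := by
    refine (h.sq_mul_log_labels.mul_isBigO (isBigO_refl (fun m => T m / (k m + 1 : ℝ) ^ 2) _)).congr
      (fun m => by field_simp) fun m => by simp only [r]; field_simp
  have hfrequencies : (fun m => ((k m : ℝ) + 1) * n m * Real.log (T m + 1)) =o[atTop] r := by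
    refine ((isBigO_refl _ _).mul (isEquivalent_log_add_const hT 1).isBigO).trans_isLittleO ?_
    refine (h.cube_mul_log_groups.mul_isBigO
      (isBigO_refl (fun m => n m / (k m + 1 : ℝ) ^ 2) _)).congr (fun m => by field_simp)
      fun m => by simp only [r]; field_simp
  have hone : ∀ᶠ m in atTop,
      1 ≤ T m * Real.log (k m + 1) + ((k m : ℝ) + 1) * n m * Real.log (T m + 1) := by
    filter_upwards [h.tendsto_nodes.eventually_ge_atTop 1,
      (Real.tendsto_log_atTop.comp hT).eventually_ge_atTop 1,
      h.tendsto_groups.eventually_gt_atTop 0] with m hn hlogT hT0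
    have hlabel : 0 ≤ T m * Real.log (k m + 1) :=
      mul_nonneg (T m).cast_nonneg (Real.log_nonneg (by simp))
    have hcard : 1 ≤ ((k m : ℝ) + 1) * n m :=
      one_le_mul_of_one_le_of_one_le (by simp) (by exact_mod_cast hn)
    have hlog : 1 ≤ Real.log (T m + 1) :=
      hlogT.trans (Real.log_le_log (Nat.cast_pos.2 hT0) (by simp))
    linarith [one_le_mul_of_one_le_of_one_le hcard hlog]
  refine (tendsto_exp_sub_mul (hlabelings.add hfrequencies) hone ?_
    (show 0 < C / 8 by positivity)).congr fun m => ?_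
  · filter_upwards [h.eventually_pos] with m hm
    have := hu m
    positivity
  · rw [sub_eq_add_neg, Real.exp_add, Real.exp_add, Real.exp_nat_mul, Real.exp_log (by positivity),
      show ((k m : ℝ) + 1) * n m = ((k m + 1) * n m : ℕ) by push_cast; rfl,
      Real.exp_nat_mul, Real.exp_log (by positivity)]
    congr 3
    simp only [r]
    field_simp

lemma tendsto_bound (h : ConsistencyRates k n T c u) (hkn : ∀ m, k m ≤ n m) (hu : ∀ m, 0 ≤ u m)
    (hC : 0 < C) :
    Tendsto (fun m => ((k m : ℝ) + 1) * (2 * Real.exp (-(c m ^ 2 * T m / 2))) +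
      (((k m : ℝ) + 1) * n m * (2 * Real.exp (-(C ^ 2 * (c m * T m)))) +
        ((k m : ℝ) + 1) ^ T m * (T m + 1) ^ ((k m + 1) * n m) *
          Real.exp (-(C * (c m * u m * n m * T m) / (8 * (k m + 1) ^ 2))))) atTop (𝓝 0) := by
  simpa only [add_zero] using h.tendsto_label_term.add
    ((h.tendsto_frequency_term hkn (pow_pos hC 2)).add (h.tendsto_mixing_term hu hC))

end ConsistencyRates

section Rates

variable {n T : ℕ → ℕ} {d v : ℕ → ℝ} {cmin : ℝ}

theorem consistencyRates_of_tendsto_leaders {k : ℕ → ℕ} (hk : Tendsto k atTop atTop)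
    (hn : Tendsto n atTop atTop) (hT : Tendsto T atTop atTop)
    (hd : ∀ m, 0 < d m) (hv : ∀ m, 0 < v m) (hcmin : 0 < cmin)
    (hlog : Tendsto (fun m => (k m : ℝ) ^ 2 * Real.log (k m) / T m) atTop (𝓝 0))
    (hlogT : Tendsto (fun m => (k m : ℝ) ^ 5 * Real.log (T m) / (d m ^ 2 * v m * T m))
      atTop (𝓝 0))
    (hlogk : Tendsto (fun m => (k m : ℝ) ^ 8 * Real.log (k m) / (d m ^ 4 * v m ^ 2 * n m))
      atTop (𝓝 0))
    (hlogn : Tendsto (fun m => (k m : ℝ) * Real.log (n m) / T m) atTop (𝓝 0)) :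
    ConsistencyRates k n T (fun m => cmin / k m) (fun m => d m ^ 2 * v m) := by
  have hK : Tendsto (fun m => (k m : ℝ)) atTop atTop := tendsto_natCast_atTop_atTop.comp hk
  have hN : Tendsto (fun m => (n m : ℝ)) atTop atTop := tendsto_natCast_atTop_atTop.comp hn
  have hT0 : ∀ᶠ m in atTop, (T m : ℝ) ≠ 0 :=
    (tendsto_natCast_atTop_atTop.comp hT).eventually_ne_atTop 0
  have hd0 m : d m ≠ 0 := (hd m).ne'
  have hv0 m : v m ≠ 0 := (hv m).ne'
  have hadd (p : ℕ) : (fun m => ((k m : ℝ) + 1) ^ p) =O[atTop] fun m => (k m : ℝ) ^ p :=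
    (isEquivalent_add_const hK 1).isBigO.pow p
  refine ⟨hn, hT, ?_, ?_, ?_, ?_, ?_⟩
  · filter_upwards [hK.eventually_gt_atTop 0] with m hm
    positivity
  · refine (isEquivalent_log_add_const hK 2).isBigO.trans_isLittleO
      ((((isLittleO_of_tendsto_div_zero hT0 hlog).mul_isBigO
        (isBigO_refl (fun m => ((k m : ℝ) ^ 2)⁻¹) _)).const_mul_right
        (pow_ne_zero 2 hcmin.ne')).congr' ?_ (.of_forall fun m => by ring))
    filter_upwards [hK.eventually_ne_atTop 0] with m hm
    field_simp
  · refine (((isLittleO_of_tendsto_div_zero hT0 hlogn).mul_isBigO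
      (isBigO_refl (fun m => (k m : ℝ)⁻¹) _)).const_mul_right
      hcmin.ne').congr' ?_ (.of_forall fun m => by ring)
    filter_upwards [hK.eventually_ne_atTop 0] with m hm
    field_simp
  · have h := isLittleO_of_tendsto_div_zero ((hN.eventually_ne_atTop 0).mono fun m hm => by
      simp [hd0, hv0, hm]) hlogk
    refine ((hadd 2).mul (isEquivalent_log_add_const hK 1).isBigO).trans_isLittleO
      (((sq_mul_log_isLittleO (u := fun m => d m ^ 2 * v m) hK hN
        (h.congr_right fun m => by ring)).const_mul_right hcmin.ne').congr_right fun m => by ring)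
  · have h := isLittleO_of_tendsto_div_zero (hT0.mono fun m hm => by simp [hd0, hv0, hm]) hlogT
    have hcube : (fun m => (k m : ℝ) ^ 3) =O[atTop] fun m => (k m : ℝ) ^ 4 :=
      ((isLittleO_pow_pow_atTop_of_lt (by norm_num)).comp_tendsto hK).isBigO
    refine (((hadd 3).trans hcube).mul (isBigO_refl _ _)).trans_isLittleO
      (((h.mul_isBigO (isBigO_refl (fun m => (k m : ℝ)⁻¹) _)).const_mul_right hcmin.ne').congr' ?_
        (.of_forall fun m => by ring))
    filter_upwards [hK.eventually_ne_atTop 0] with m hm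
    field_simp

theorem consistencyRates_of_fixed_leaders (k : ℕ)
    (hn : Tendsto n atTop atTop) (hT : Tendsto T atTop atTop)
    (hd : ∀ m, 0 < d m) (hv : ∀ m, 0 < v m) (hcmin : 0 < cmin)
    (hlogT : Tendsto (fun m => Real.log (T m) / (d m ^ 2 * v m * T m)) atTop (𝓝 0))
    (hdv : Tendsto (fun m => d m ^ 4 * v m ^ 2 * n m) atTop atTop)
    (hlogn : Tendsto (fun m => Real.log (n m) / T m) atTop (𝓝 0)) :
    ConsistencyRates (fun _ => k) n T (fun _ => cmin) (fun m => d m ^ 2 * v m) := by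
  have hN : Tendsto (fun m => (n m : ℝ)) atTop atTop := tendsto_natCast_atTop_atTop.comp hn
  have hT' : Tendsto (fun m => (T m : ℝ)) atTop atTop := tendsto_natCast_atTop_atTop.comp hT
  have hsignal : Tendsto (fun m => d m ^ 2 * v m * n m) atTop atTop := by
    refine (Real.tendsto_sqrt_atTop.comp (hdv.atTop_mul_atTop₀ hN)).congr fun m => ?_
    rw [Function.comp_apply,
      show d m ^ 4 * v m ^ 2 * n m * n m = (d m ^ 2 * v m * n m) ^ 2 by ring]
    have := hv m
    exact Real.sqrt_sq (by positivity)
  refine ⟨hn, hT, .of_forall fun _ => hcmin,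
    (isLittleO_const_id_atTop _).comp_tendsto (hT'.const_mul_atTop (pow_pos hcmin 2)), ?_,
    (isLittleO_const_id_atTop _).comp_tendsto ?_, ?_⟩
  · exact (isLittleO_of_tendsto_div_zero (hT'.eventually_ne_atTop 0) hlogn).const_mul_right
      hcmin.ne'
  · simpa only [mul_assoc] using hsignal.const_mul_atTop hcmin
  · have h := isLittleO_of_tendsto_div_zero ((hT'.eventually_ne_atTop 0).mono fun m hm => by
      have := (hd m).ne'
      have := (hv m).ne'
      positivity) hlogT
    exact ((h.const_mul_left _).const_mul_right hcmin.ne').congr_right fun m => by ring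

end Rates

theorem theorem10_general {Ω : ℕ → Type*} [∀ m, MeasurableSpace (Ω m)] (μ : ∀ m, Measure (Ω m))
    {n T k : ℕ → ℕ} {c d v : ℕ → ℝ} {b : ℝ} (P : ∀ m, HubParams (k m) (n m))
    (zstar : ∀ m, Ω m → Fin (T m) → Fin (k m + 1)) (G : ∀ m, Ω m → Fin (T m) → Fin (n m) → Bool)
    (zhat : ∀ m, Ω m → Fin (T m) → Fin (k m + 1)) (hd : ∀ m, 0 ≤ d m) (hv : ∀ m, 0 ≤ v m)
    (hb : b < 1) (hρ : ∀ m i, c m ≤ (P m).ρ i) (hsep : ∀ m, (P m).Separated (d m) (v m))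
    (hcross : ∀ᶠ m in atTop, (P m).CrossLE b)
    (hrates : ConsistencyRates k n T c fun m => d m ^ 2 * v m)
    (hsample : ∀ m, IsHubSample (P m) (μ m) (zstar m) (G m))
    (hzhat : ∀ m ω, IsMaxProfile (P m).le (G m ω) (zhat m ω)) :
    IsLittleOP μ fun m ω => maxError (P m) (G m ω) (zhat m ω) := by
  intro ε hε
  obtain ⟨e, he, hlt⟩ : ∃ e : ℝ, 0 < e ∧ e < min 1 (min (ε / 3) ((1 - b) / 2)) :=
    exists_between (by simp only [lt_min_iff]; exact ⟨one_pos, by linarith, by linarith⟩)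
  obtain ⟨he1, heε, heb⟩ : e < 1 ∧ e < ε / 3 ∧ e < (1 - b) / 2 := by
    simpa only [lt_min_iff] using hlt
  have hbound := ENNReal.tendsto_ofReal (hrates.tendsto_bound (fun m => (P m).le)
    (fun m => mul_nonneg (sq_nonneg (d m)) (hv m)) he)
  rw [ENNReal.ofReal_zero] at hbound
  refine tendsto_of_tendsto_of_tendsto_of_le_of_le' tendsto_const_nhds hbound
    (.of_forall fun _ => zero_le) ?_
  filter_upwards [hrates.eventually_pos, hcross, hrates.tendsto_groups.eventually_gt_atTop 0]
    with m hc hcrossm hT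
  exact (hsample m).measure_maxError_le (hzhat m) (hρ m) (hsep m) hcrossm hc hT (hd m)
    (hv m) he he1 (by linarith) (by linarith)

theorem theorem10 {Ω : ℕ → Type*} [∀ m, MeasurableSpace (Ω m)] (μ : ∀ m, Measure (Ω m))
    [∀ m, IsProbabilityMeasure (μ m)] (n T : ℕ → ℕ) (d v : ℕ → ℝ)
    (hn : Tendsto n atTop atTop) (hT : Tendsto T atTop atTop)
    (hd : ∀ m, 0 < d m) (hv : ∀ m, 0 < v m) :
    -- the number of leaders tends to infinity
    (∀ (nL : ℕ → ℕ) (P : ∀ m, HubParams (nL m) (n m)) (cmin cmax c₀ : ℝ)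
      (zstar : ∀ m, Ω m → Fin (T m) → Fin (nL m + 1))
      (G : ∀ m, Ω m → Fin (T m) → Fin (n m) → Bool)
      (zhat : ∀ m, Ω m → Fin (T m) → Fin (nL m + 1)),
      Tendsto nL atTop atTop →
      0 < cmin → 0 < cmax → 0 < c₀ →
      (∀ m i, cmin / nL m ≤ (P m).ρ i ∧ (P m).ρ i ≤ cmax / nL m) →
      (∀ m, (P m).Separated (d m) (v m)) →
      (∀ m, (P m).CrossLE (c₀ / nL m)) →
      Tendsto (fun m => (nL m : ℝ) ^ 2 * Real.log (nL m) / T m) atTop (𝓝 0) →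
      Tendsto (fun m => (nL m : ℝ) ^ 5 * Real.log (T m) / (d m ^ 2 * v m * T m))
        atTop (𝓝 0) →
      Tendsto (fun m => (nL m : ℝ) ^ 8 * Real.log (nL m) / (d m ^ 4 * v m ^ 2 * n m))
        atTop (𝓝 0) →
      Tendsto (fun m => (nL m : ℝ) * Real.log (n m) / T m) atTop (𝓝 0) →
      (∀ m, IsHubSample (P m) (μ m) (zstar m) (G m)) →
      (∀ m ω, IsMaxProfile (P m).le (G m ω) (zhat m ω)) →
      IsLittleOP μ (fun m ω => maxError (P m) (G m ω) (zhat m ω))) ∧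
    -- the number of leaders is fixed
    (∀ (nL : ℕ) (P : ∀ m, HubParams nL (n m)) (cmin b : ℝ)
      (zstar : ∀ m, Ω m → Fin (T m) → Fin (nL + 1))
      (G : ∀ m, Ω m → Fin (T m) → Fin (n m) → Bool)
      (zhat : ∀ m, Ω m → Fin (T m) → Fin (nL + 1)),
      0 < cmin → b < 1 →
      (∀ m i, cmin ≤ (P m).ρ i) →
      (∀ m, (P m).Separated (d m) (v m)) →
      (∀ m, (P m).CrossLE b) →
      Tendsto (fun m => Real.log (T m) / (d m ^ 2 * v m * T m)) atTop (𝓝 0) →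
      Tendsto (fun m => d m ^ 4 * v m ^ 2 * n m) atTop atTop →
      Tendsto (fun m => Real.log (n m) / T m) atTop (𝓝 0) →
      (∀ m, IsHubSample (P m) (μ m) (zstar m) (G m)) →
      (∀ m ω, IsMaxProfile (P m).le (G m ω) (zhat m ω)) →
      IsLittleOP μ (fun m ω => maxError (P m) (G m ω) (zhat m ω))) := by
  have hd' m := (hd m).le
  have hv' m := (hv m).le
  refine ⟨fun nL P cmin cmax c₀ zstar G zhat hnL hcmin _ _ hρ hsep hcross hlog hlogT hlogk hlogn
    hsample hzhat => ?_, fun nL P cmin b zstar G zhat hcmin hb hρ hsep hcross hlogT hdv hlogn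
    hsample hzhat => ?_⟩
  · have hc₀ : ∀ᶠ m in atTop, c₀ / nL m ≤ 1 / 2 :=
      (tendsto_const_nhds.div_atTop (tendsto_natCast_atTop_atTop.comp hnL)).eventually_le_const
        one_half_pos
    exact theorem10_general μ P zstar G zhat hd' hv' one_half_lt_one (fun m i => (hρ m i).1) hsep
      (hc₀.mono fun m hm i j hij => (hcross m i j hij).trans hm)
      (consistencyRates_of_tendsto_leaders hnL hn hT hd hv hcmin hlog hlogT hlogk hlogn)
      hsample hzhat
  · exact theorem10_general μ P zstar G zhat hd' hv' hb hρ hsep (.of_forall hcross)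
      (consistencyRates_of_fixed_leaders nL hn hT hd hv hcmin hlogT hdv hlogn) hsample hzhat
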